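/- **Conventions.** A graph is a connected metric graph without loops (multiple edges are allowed), all of whose edges have length $1$; it carries the path metric $d$. It has bounded valence if there is a constant bounding the number of edges adjacent to every vertex. A geodesic metric space is $\delta$-hyperbolic if each side of every geodesic triangle lies in the $\delta$-neighbourhood of the union of the other two sides. The boundary $\partial\Gamma$ is the set of geodesic rays $[0,\infty)\to\Gamma$ modulo finite Hausdorff distance, and $\partial^3\Gamma$ is the set of triples of pairwise distinct points of $\partial\Gamma$. A point $x$ is a $D$-barycenter of $(\xi_1,\xi_2,\xi_3)\in\partial^3\Gamma$ if $x$ is at distance at most $D$ from every geodesic line joining $\xi_i$ and $\xi_j$, for all $i\neq j$. Fix a function $\delta\mapsto D(\delta)$ (for example one such that every triple in $\partial^3X$ has a $D(\delta)$-barycenter whenever $X$ is a proper $\delta$-hyperbolic geodesic space). A barycenter map of a $\delta$-hyperbolic graph $\Gamma$ is a map $\partial^3\Gamma\to\Gamma$ sending each triple to one of its $D(\delta)$-barycenters. It is $L$-coarsely surjective if every point of $\Gamma$ is at distance at most $L$ from its image. **Theorem.** For all $\delta\ge 0$ and $L\ge 0$ there are constants $a>0$ and $b>1$, depending only on $\delta$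 and $L$ (the function $D(\cdot)$ being fixed), such that the following holds. Let $\Gamma$ be a $\delta$-hyperbolic metric graph of bounded valence that has an $L$-coarsely surjective barycenter map $\partial^3\Gamma\to\Gamma$. Then $\Gamma$ has exponential growth with parameters $(a,b)$: for every vertex $u$ of $\Gamma$ and every integer $n\ge 0$, the number $\|B(u,n)\|$ of vertices of $\Gamma$ in the closed ball of radius $n$ around $u$ is finite and satisfies $$\|B(u,n)\|\ \ge\ a\,b^{\,n}.$$ -/

import Mathlib

open scoped NNReal unitInterval

/-! ### Metric graphs -/

/-- `EdgeChain edge x y ℓ`: there is a piecewise linear path of total length `ℓ` from `x` to `y`.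
It is a finite concatenation of pieces, each running inside one edge from the point with parameter
`s` to the point with parameter `t`, which has length `|s - t|` since edges have length one. -/
inductive EdgeChain {X E : Type*} (edge : E → I → X) : X → X → ℝ → Prop
  | nil (x : X) : EdgeChain edge x x 0
  | cons (e : E) (s t : I) {y : X} {ℓ : ℝ} (h : EdgeChain edge (edge e t) y ℓ) :
      EdgeChain edge (edge e s) y (|(s : ℝ) - t| + ℓ)

/-- The structure of a connected metric graph without loops, all of whose edges have length one,
on a metric space `X`. Multiple edges are allowed.
`X` is obtained, as a set, by gluing the end points of the unit intervals `{e} × [0, 1]` to the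
vertices, and the metric of `X` is the associated path metric. -/
structure MetricGraph (X : Type*) [MetricSpace X] where
  /-- The vertex set. -/
  vertices : Set X
  /-- The index type of the edges. -/
  Edge : Type*
  /-- The parametrization of an edge by the unit interval. -/
  edge : Edge → I → X
  edge_zero_mem : ∀ e, edge e 0 ∈ vertices
  edge_one_mem : ∀ e, edge e 1 ∈ vertices
  /-- No edge is a loop. -/
  edge_zero_ne_one : ∀ e, edge e 0 ≠ edge e 1
  interior_notMem : ∀ e, ∀ t ∈ Set.Ioo (0 : I) 1, edge e t ∉ vertices
  interior_injective : ∀ e e', ∀ t ∈ Set.Ioo (0 : I) 1, ∀ t' ∈ Set.Ioo (0 : I) 1,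
    edge e t = edge e' t' → e = e' ∧ t = t'
  exists_of_notMem : ∀ x, x ∉ vertices → ∃ e, ∃ t ∈ Set.Ioo (0 : I) 1, edge e t = x
  /-- Any two points are joined by a piecewise linear path. -/
  connected : ∀ x y, ∃ ℓ, EdgeChain edge x y ℓ
  /-- The distance is the infimum of the lengths of piecewise linear paths. -/
  isGLB_dist : ∀ x y, IsGLB {ℓ | EdgeChain edge x y ℓ} (dist x y)

namespace MetricGraph

variable {X : Type*} [MetricSpace X]

/-- The edges adjacent to a point `u`. -/
def edgesAt (Γ : MetricGraph X) (u : X) : Set Γ.Edge :=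
  {e | Γ.edge e 0 = u ∨ Γ.edge e 1 = u}

/-- The valences of the vertices are bounded by a common constant. -/
def BoundedValence (Γ : MetricGraph X) : Prop :=
  ∃ N : ℕ, ∀ u ∈ Γ.vertices, (Γ.edgesAt u).encard ≤ N

/-- The vertices in the closed ball of radius `n` around `u`. -/
def ballVertices (Γ : MetricGraph X) (u : X) (n : ℕ) : Set X :=
  {v | v ∈ Γ.vertices ∧ dist u v ≤ n}

/-- Exponential growth with parameters `(a, b)`: every ball of radius `n` around a vertex contains
finitely many vertices, and at least `a * b ^ n` of them. -/
def HasExponentialGrowthWith (Γ : MetricGraph X) (a b : ℝ) : Prop :=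
  0 < a ∧ 1 < b ∧ ∀ u ∈ Γ.vertices, ∀ n : ℕ,
    (Γ.ballVertices u n).Finite ∧ a * b ^ n ≤ ((Γ.ballVertices u n).ncard : ℝ)

end MetricGraph

/-! ### Hyperbolicity -/

/-- `S` is (the image of) a geodesic segment joining `x` and `y`. -/
def IsGeodesicSegment {X : Type*} [MetricSpace X] (x y : X) (S : Set X) : Prop :=
  ∃ c : ℝ → X, c 0 = x ∧ c (dist x y) = y ∧
    (∀ s ∈ Set.Icc 0 (dist x y), ∀ t ∈ Set.Icc 0 (dist x y), dist (c s) (c t) = |s - t|) ∧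
    S = c '' Set.Icc 0 (dist x y)

/-- `X` is a `δ`-hyperbolic geodesic space: any two points are joined by a geodesic segment, and
each side of a geodesic triangle lies in the `δ`-neighbourhood of the union of the two others.
(The condition on one side gives the other two by permuting the vertices.) -/
structure IsDeltaHyperbolic (δ : ℝ) (X : Type*) [MetricSpace X] : Prop where
  geodesic : ∀ x y : X, ∃ S, IsGeodesicSegment x y S
  slim : ∀ (x y z : X) (S₁ S₂ S₃ : Set X), IsGeodesicSegment x y S₁ →
    IsGeodesicSegment y z S₂ → IsGeodesicSegment z x S₃ →
      ∀ p ∈ S₁, ∃ q ∈ S₂ ∪ S₃, dist p q ≤ δ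

/-! ### The geodesic boundary -/

/-- Geodesic rays `[0, ∞) → X`. -/
def GeodesicRay (X : Type*) [MetricSpace X] : Type _ := {c : ℝ≥0 → X // Isometry c}

/-- Geodesic lines `ℝ → X`. -/
def GeodesicLine (X : Type*) [MetricSpace X] : Type _ := {c : ℝ → X // Isometry c}

/-- Two geodesic rays are related if their Hausdorff distance is finite. -/
def geodesicRaySetoid (X : Type*) [MetricSpace X] : Setoid (GeodesicRay X) where
  r α β := Metric.hausdorffEDist (Set.range α.1) (Set.range β.1) < ⊤
  iseqv :=
    { refl := fun α => by simp [Metric.hausdorffEDist_self]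
      symm := fun {α β} h => by rwa [Metric.hausdorffEDist_comm]
      trans := fun {α β γ} h₁ h₂ =>
        lt_of_le_of_lt Metric.hausdorffEDist_triangle (ENNReal.add_lt_top.2 ⟨h₁, h₂⟩) }

/-- The geodesic boundary `∂X`. -/
def GeodesicBoundary (X : Type*) [MetricSpace X] : Type _ := Quotient (geodesicRaySetoid X)

namespace GeodesicLine

variable {X : Type*} [MetricSpace X]

/-- The ray `t ↦ γ t`, `t ≥ 0`, of a geodesic line. -/
def posRay (γ : GeodesicLine X) : GeodesicRay X :=
  ⟨fun t => γ.1 (t : ℝ), γ.2.comp isometry_subtype_coe⟩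

/-- The ray `t ↦ γ (-t)`, `t ≥ 0`, of a geodesic line. -/
def negRay (γ : GeodesicLine X) : GeodesicRay X :=
  ⟨fun t => γ.1 (-(t : ℝ)), γ.2.comp ((IsometryEquiv.neg ℝ).isometry.comp isometry_subtype_coe)⟩

/-- The geodesic line `γ` joins `ξ` to `η`, i.e. `γ(-∞) = ξ` and `γ(∞) = η`. -/
def Joins (γ : GeodesicLine X) (ξ η : GeodesicBoundary X) : Prop :=
  (Quotient.mk (geodesicRaySetoid X) γ.negRay : GeodesicBoundary X) = ξ ∧
    (Quotient.mk (geodesicRaySetoid X) γ.posRay : GeodesicBoundary X) = η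

end GeodesicLine

/-! ### Barycenters -/

/-- The set `∂³X` of triples of pairwise distinct boundary points. -/
def BoundaryTriple (X : Type*) [MetricSpace X] : Type _ :=
  {ξ : Fin 3 → GeodesicBoundary X // Function.Injective ξ}

/-- `x` is a `D`-barycenter of the ideal triangles with vertices `ξ₁, ξ₂, ξ₃`: it is at distance
at most `D` from every geodesic line joining two of these points. -/
def IsBarycenter {X : Type*} [MetricSpace X] (D : ℝ) (ξ : BoundaryTriple X) (x : X) : Prop :=
  ∀ i j : Fin 3, i ≠ j → ∀ γ : GeodesicLine X, γ.Joins (ξ.1 i) (ξ.1 j) →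
    Metric.infDist x (Set.range γ.1) ≤ D

/-- A barycenter map with constant `D`: it sends every triple to one of its `D`-barycenters. -/
def IsBarycenterMap {X : Type*} [MetricSpace X] (D : ℝ) (bary : BoundaryTriple X → X) : Prop :=
  ∀ ξ, IsBarycenter D ξ (bary ξ)

/-- The `L`-neighbourhood of the image of `f` is the whole space. -/
def IsCoarselySurjective {A X : Type*} [MetricSpace X] (L : ℝ) (f : A → X) : Prop :=
  ∀ x, ∃ a, dist x (f a) ≤ L

/-!
A point near a barycenter of an ideal triangle is a branching point: whatever direction one comes
from, at least two of the three ends of the triangle lead away from it. If the barycenter map is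
coarsely surjective, then this happens near every vertex, with uniform constants, and the number of
vertices seen doubles whenever the radius grows by a fixed amount.

To make this precise, slim triangles are turned into the four point condition
`(x | z)_w ≥ min ((x | y)_w) ((y | z)_w) - 3 δ` for Gromov products
(`IsDeltaHyperbolic.min_gromovProduct_le`). For every vertex `v`, every point `u` and every `r`,
there are two vertices `y₁`, `y₂` at distance about `r` from `v` such that the products
`(u | y₁)_v`, `(u | y₂)_v`, `(y₁ | y₂)_v` are bounded by a constant that does not depend on `r`
(`MetricGraph.exists_branches`). Let the shadow of radius `n` at `v` as seen from `u` consist of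
the vertices `w` with `d(v, w) ≤ n` and `(u | w)_v ≤ C`. If `r` is large, then the shadows of radius
`n` at `y₁` and `y₂` as seen from `v` are disjoint and contained in the shadow of radius `n + r + 1`
at `v` as seen from `u`: a point `w` of the shadow at `yᵢ` has large product `(yᵢ | w)_v`, so that
the four point condition bounds `(u | w)_v` by `(u | yᵢ)_v + 3 δ`. Hence shadows grow exponentially
(`MetricGraph.two_pow_le_ncard_shadow`), and so do balls.

The definition of a barycenter says nothing about a triple of boundary points that are not joined by
geodesic lines. These lines exist in proper hyperbolic spaces (`IsDeltaHyperbolic.exists_joins`),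
and a metric graph of bounded valence is proper, because closed stars of vertices are compact.
-/

/-! ### Geodesic segments -/

section Segment

variable {X : Type*} [MetricSpace X] {x y : X} {S : Set X}

theorem isGeodesicSegment_image {c : ℝ → X} {ℓ : ℝ} (hℓ : 0 ≤ ℓ)
    (hc : ∀ s ∈ Set.Icc 0 ℓ, ∀ t ∈ Set.Icc 0 ℓ, dist (c s) (c t) = |s - t|) :
    IsGeodesicSegment (c 0) (c ℓ) (c '' Set.Icc 0 ℓ) := by
  have h : dist (c 0) (c ℓ) = ℓ := by
    rw [hc 0 ⟨le_rfl, hℓ⟩ ℓ ⟨hℓ, le_rfl⟩, zero_sub, abs_neg, abs_of_nonneg hℓ]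
  exact ⟨c, rfl, by rw [h], by rwa [h], by rw [h]⟩

theorem IsGeodesicSegment.symm (h : IsGeodesicSegment x y S) : IsGeodesicSegment y x S := by
  obtain ⟨c, h0, h1, hc, rfl⟩ := h
  refine ⟨fun t => c (dist x y - t), by simpa, by simp [dist_comm y x, h0], ?_, ?_⟩
  · intro s hs t ht
    rw [dist_comm y x] at hs ht
    rw [hc _ ⟨by linarith [hs.2], by linarith [hs.1]⟩ _ ⟨by linarith [ht.2], by linarith [ht.1]⟩,
      abs_sub_comm]
    congr 1; ring
  · rw [dist_comm y x]
    ext p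
    constructor
    · rintro ⟨t, ht, rfl⟩
      exact ⟨dist x y - t, ⟨by linarith [ht.2], by linarith [ht.1]⟩, by simp⟩
    · rintro ⟨t, ht, rfl⟩
      exact ⟨dist x y - t, ⟨by linarith [ht.2], by linarith [ht.1]⟩, rfl⟩

theorem IsGeodesicSegment.dist_add_dist (h : IsGeodesicSegment x y S) {p : X} (hp : p ∈ S) :
    dist x p + dist p y = dist x y := by
  obtain ⟨c, h0, h1, hc, rfl⟩ := h
  obtain ⟨t, ht, rfl⟩ := hp
  have e0 := hc 0 ⟨le_rfl, dist_nonneg⟩ t ht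
  have e1 := hc t ht _ ⟨dist_nonneg, le_rfl⟩
  rw [h0, zero_sub, abs_neg, abs_of_nonneg ht.1] at e0
  rw [h1, abs_sub_comm, abs_of_nonneg (by linarith [ht.2])] at e1
  linarith

theorem IsGeodesicSegment.continuousOn {c : ℝ → X} {s : Set ℝ}
    (hc : ∀ a ∈ s, ∀ b ∈ s, dist (c a) (c b) = |a - b|) : ContinuousOn c s := by
  have : LipschitzOnWith 1 c s := LipschitzOnWith.of_dist_le_mul fun a ha b hb => by
    rw [hc a ha b hb, Real.dist_eq]; simp
  exact this.continuousOn

theorem IsGeodesicSegment.isCompact (h : IsGeodesicSegment x y S) : IsCompact S := by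
  obtain ⟨c, h0, h1, hc, rfl⟩ := h
  exact isCompact_Icc.image_of_continuousOn (continuousOn hc)

theorem IsGeodesicSegment.nonempty (h : IsGeodesicSegment x y S) : S.Nonempty := by
  obtain ⟨c, h0, h1, hc, rfl⟩ := h
  exact (Set.nonempty_Icc.2 dist_nonneg).image _

theorem IsGeodesicSegment.isPreconnected (h : IsGeodesicSegment x y S) : IsPreconnected S := by
  obtain ⟨c, h0, h1, hc, rfl⟩ := h
  exact isPreconnected_Icc.image _ (continuousOn hc)

theorem IsGeodesicSegment.left_mem (h : IsGeodesicSegment x y S) : x ∈ S := by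
  obtain ⟨c, h0, h1, hc, rfl⟩ := h
  exact ⟨0, ⟨le_rfl, dist_nonneg⟩, h0⟩

theorem IsGeodesicSegment.exists_dist_eq (h : IsGeodesicSegment x y S) {r : ℝ} (hr : 0 ≤ r)
    (hr' : r ≤ dist x y) : ∃ p ∈ S, dist x p = r := by
  obtain ⟨c, h0, h1, hc, rfl⟩ := h
  refine ⟨c r, ⟨r, ⟨hr, hr'⟩, rfl⟩, ?_⟩
  rw [← h0, hc 0 ⟨le_rfl, dist_nonneg⟩ r ⟨hr, hr'⟩, zero_sub, abs_neg, abs_of_nonneg hr]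

end Segment

/-! ### Gromov products -/

/-- The Gromov product `(x | y)_w`. -/
noncomputable def gromovProduct {X : Type*} [MetricSpace X] (w x y : X) : ℝ :=
  (dist w x + dist w y - dist x y) / 2

section GromovProduct

variable {X : Type*} [MetricSpace X]

theorem gromovProduct_comm (w x y : X) : gromovProduct w x y = gromovProduct w y x := by
  unfold gromovProduct; rw [dist_comm x y]; ring

/-- The Gromov products of `x` and `z` at `w` and of `w` and `z` at `x` add up to the length of
the side from `w` to `x`. -/
theorem gromovProduct_add_gromovProduct (w x z : X) :
    gromovProduct w x z + gromovProduct x w z = dist w x := by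
  unfold gromovProduct; rw [dist_comm x w]; ring

theorem gromovProduct_le_add_dist (w x y y' : X) :
    gromovProduct w x y' ≤ gromovProduct w x y + dist y y' := by
  unfold gromovProduct
  linarith [dist_triangle w y y', dist_triangle x y' y, dist_comm y y']

/-- Moving an argument of the Gromov product along a geodesic towards the base point does not
increase the product. -/
theorem gromovProduct_le_of_between {w y y' : X} (u : X) (h : dist w y' + dist y' y = dist w y) :
    gromovProduct w u y' ≤ gromovProduct w u y := by
  unfold gromovProduct
  linarith [dist_triangle u y' y]

theorem gromovProduct_le_dist_of_between {x y p : X} (w : X)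
    (h : dist x p + dist p y = dist x y) : gromovProduct w x y ≤ dist w p := by
  unfold gromovProduct
  linarith [dist_triangle w p x, dist_triangle w p y, dist_comm p x]

variable {δ : ℝ}

/-- The distance from `w` to a side `[x, y]` is at most `(x | y)_w` up to `2 δ`: by connectedness,
the side contains a point which is `δ`-close to both of the other sides. -/
theorem IsDeltaHyperbolic.exists_dist_le (h : IsDeltaHyperbolic δ X) (w : X) {x y : X} {S : Set X}
    (hS : IsGeodesicSegment x y S) : ∃ p ∈ S, dist w p ≤ gromovProduct w x y + 2 * δ := by
  obtain ⟨A, hA⟩ := h.geodesic w x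
  obtain ⟨B, hB⟩ := h.geodesic w y
  have hδ : 0 ≤ δ := by
    obtain ⟨q, -, hq⟩ := h.slim x y w S B A hS hB.symm hA x hS.left_mem
    exact dist_nonneg.trans hq
  have hcl : ∀ C : Set X, IsClosed {p | Metric.infDist p C ≤ δ} := fun C =>
    isClosed_le (Metric.continuous_infDist_pt C) continuous_const
  have hmem : ∀ {C : Set X} {p q : X}, q ∈ C → dist p q ≤ δ → p ∈ {p | Metric.infDist p C ≤ δ} :=
    fun hq hpq => (Metric.infDist_le_dist_of_mem hq).trans hpq
  have hcov : S ⊆ {p | Metric.infDist p A ≤ δ} ∪ {p | Metric.infDist p B ≤ δ} := by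
    intro p hp
    obtain ⟨q, hq | hq, hpq⟩ := h.slim x y w S B A hS hB.symm hA p hp
    · exact Or.inr (hmem hq hpq)
    · exact Or.inl (hmem hq hpq)
  obtain ⟨p, hpS, hpA, hpB⟩ := isPreconnected_closed_iff.1 hS.isPreconnected _ _ (hcl A) (hcl B) hcov
    ⟨x, hS.left_mem, hmem hA.symm.left_mem (by simpa)⟩
    ⟨y, hS.symm.left_mem, hmem hB.symm.left_mem (by simpa)⟩
  obtain ⟨a, ha, hpa⟩ := hA.isCompact.exists_infDist_eq_dist hA.nonempty p
  obtain ⟨b, hb, hpb⟩ := hB.isCompact.exists_infDist_eq_dist hB.nonempty p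
  refine ⟨p, hpS, ?_⟩
  have h1 : dist p a ≤ δ := hpa ▸ hpA
  have h2 : dist p b ≤ δ := hpb ▸ hpB
  have h3 := hA.dist_add_dist ha
  have h4 := hB.dist_add_dist hb
  have h5 := hS.dist_add_dist hpS
  unfold gromovProduct
  linarith [dist_triangle w a p, dist_triangle w b p, dist_triangle p a x, dist_triangle p b y,
    dist_comm p a, dist_comm p b, dist_comm p x]

/-- Slim triangles imply the four point condition. -/
theorem IsDeltaHyperbolic.min_gromovProduct_le (h : IsDeltaHyperbolic δ X) (w x y z : X) :
    min (gromovProduct w x y) (gromovProduct w y z) ≤ gromovProduct w x z + 3 * δ := by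
  obtain ⟨A, hA⟩ := h.geodesic x z
  obtain ⟨B, hB⟩ := h.geodesic x y
  obtain ⟨C, hC⟩ := h.geodesic y z
  obtain ⟨p, hp, hwp⟩ := h.exists_dist_le w hA
  obtain ⟨q, hq | hq, hpq⟩ := h.slim x z y A C B hA hC.symm hB.symm p hp
  · have := gromovProduct_le_dist_of_between w (hC.dist_add_dist hq)
    refine (min_le_right _ _).trans ?_
    linarith [dist_triangle w p q]
  · have := gromovProduct_le_dist_of_between w (hB.dist_add_dist hq)
    refine (min_le_left _ _).trans ?_
    linarith [dist_triangle w p q]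

end GromovProduct

/-! ### Local structure and properness of metric graphs -/

theorem EdgeChain.nonneg {X E : Type*} {edge : E → I → X} {x y : X} {ℓ : ℝ}
    (h : EdgeChain edge x y ℓ) : 0 ≤ ℓ := by
  induction h with
  | nil x => exact le_rfl
  | cons e s t h ih => positivity

namespace MetricGraph

variable {X : Type*} [MetricSpace X] (Γ : MetricGraph X)

theorem dist_edge_le (e : Γ.Edge) (s t : I) : dist (Γ.edge e s) (Γ.edge e t) ≤ |(s : ℝ) - t| := by
  have := (Γ.isGLB_dist (Γ.edge e s) (Γ.edge e t)).1 (EdgeChain.cons e s t (EdgeChain.nil _))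
  simpa using this

theorem continuous_edge (e : Γ.Edge) : Continuous (Γ.edge e) := by
  have : LipschitzWith 1 (Γ.edge e) := LipschitzWith.of_dist_le_mul fun a b => by
    simpa [Subtype.dist_eq, Real.dist_eq] using Γ.dist_edge_le e a b
  exact this.continuous

theorem eq_zero_or_one_of_mem_vertices {e : Γ.Edge} {t : I} (h : Γ.edge e t ∈ Γ.vertices) :
    t = 0 ∨ t = 1 := by
  by_contra! hne
  exact Γ.interior_notMem e t ⟨unitInterval.pos_iff_ne_zero.2 hne.1,
    unitInterval.lt_one_iff_ne_one.2 hne.2⟩ h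

/-- The vertex `v` together with the points that are reached from `v` by running along one edge for
a length at most `ρ`. For `0 ≤ ρ < 1` this is a ball in the open star of `v`. -/
def starBall (v : X) (ρ : ℝ) : Set X :=
  {x | x = v ∨ ∃ e, ∃ s : I, Γ.edge e s = x ∧
    ((Γ.edge e 0 = v ∧ (s : ℝ) ≤ ρ) ∨ (Γ.edge e 1 = v ∧ 1 - (s : ℝ) ≤ ρ))}

variable {Γ}

theorem starBall_inter_vertices {v w : X} {ρ : ℝ} (hρ : ρ < 1) (hw : w ∈ Γ.vertices)
    (h : w ∈ Γ.starBall v ρ) : w = v := by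
  obtain h | ⟨e, s, rfl, h⟩ := h
  · exact h
  · obtain rfl | rfl := Γ.eq_zero_or_one_of_mem_vertices hw
    · obtain h | h := h
      · exact h.1
      · simp at h; linarith
    · obtain h | h := h
      · simp at h; linarith
      · exact h.1

theorem edge_mem_starBall {v : X} (hv : v ∈ Γ.vertices) {e : Γ.Edge} {s : I} (t : I) {ρ : ℝ}
    (hρ1 : ρ < 1) (hρ0 : 0 ≤ ρ) (h : Γ.edge e s ∈ Γ.starBall v ρ) :
    Γ.edge e t ∈ Γ.starBall v (ρ + |(s : ℝ) - t|) := by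
  right
  have hst := le_abs_self ((s : ℝ) - t)
  have hst' := neg_abs_le ((s : ℝ) - t)
  by_cases hs : Γ.edge e s ∈ Γ.vertices
  · have hsv := starBall_inter_vertices hρ1 hs h
    obtain rfl | rfl := Γ.eq_zero_or_one_of_mem_vertices hs
    · exact ⟨e, t, rfl, Or.inl ⟨hsv, by
      simp only [Set.Icc.coe_zero] at hst' ⊢; linarith⟩⟩
    · exact ⟨e, t, rfl, Or.inr ⟨hsv, by
      simp only [Set.Icc.coe_one] at hst ⊢; linarith⟩⟩
  · have key : ∀ e' (s' : I), Γ.edge e' s' ∉ Γ.vertices → s' ∈ Set.Ioo (0 : I) 1 := by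
      intro e' s' h'
      refine ⟨unitInterval.pos_iff_ne_zero.2 ?_, unitInterval.lt_one_iff_ne_one.2 ?_⟩
      · rintro rfl; exact h' (Γ.edge_zero_mem e')
      · rintro rfl; exact h' (Γ.edge_one_mem e')
    obtain h | ⟨e', s', he, h⟩ := h
    · exact absurd (h ▸ hv) hs
    · obtain ⟨rfl, rfl⟩ := Γ.interior_injective e' e s' (key _ _ (he ▸ hs)) s (key _ _ hs) he
      refine ⟨e', t, rfl, h.imp ?_ ?_⟩
      · rintro ⟨h0, h1⟩; exact ⟨h0, by linarith⟩
      · rintro ⟨h0, h1⟩; exact ⟨h0, by linarith⟩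

/-- A path that starts in the open star of `v` stays in it if it is too short to reach the other
ends of the edges at `v`. -/
theorem mem_starBall_of_edgeChain {v : X} (hv : v ∈ Γ.vertices) {x y : X} {ℓ : ℝ}
    (h : EdgeChain Γ.edge x y ℓ) : ∀ {ρ : ℝ}, 0 ≤ ρ → ρ + ℓ < 1 → x ∈ Γ.starBall v ρ →
      y ∈ Γ.starBall v (ρ + ℓ) := by
  induction h with
  | nil x => intro ρ _ _ h; simpa using h
  | cons e s t h ih =>
    intro ρ h0 h1 hx
    have hℓ := h.nonneg
    have := edge_mem_starBall hv t
      (by linarith [abs_nonneg ((s : ℝ) - t)]) h0 hx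
    rw [← add_assoc] at h1 ⊢
    exact ih (by positivity) h1 this

theorem exists_mem_starBall {v y : X} (hv : v ∈ Γ.vertices) (h : dist v y < 1) :
    ∃ ρ < 1, y ∈ Γ.starBall v ρ := by
  obtain ⟨ℓ, hℓ, -, h1⟩ := (Γ.isGLB_dist v y).exists_between h
  have := mem_starBall_of_edgeChain (ρ := 0) hv hℓ le_rfl (by simpa) (Or.inl rfl)
  exact ⟨0 + ℓ, by simpa, this⟩

/-- Distinct vertices have distance at least one. -/
theorem eq_of_dist_lt_one {v w : X} (hv : v ∈ Γ.vertices) (hw : w ∈ Γ.vertices)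
    (h : dist v w < 1) : w = v := by
  obtain ⟨ρ, hρ, hmem⟩ := exists_mem_starBall hv h
  exact starBall_inter_vertices hρ hw hmem

theorem exists_vertex_dist_le (x : X) : ∃ v ∈ Γ.vertices, dist v x ≤ 1 / 2 := by
  by_cases hx : x ∈ Γ.vertices
  · exact ⟨x, hx, by simp⟩
  · obtain ⟨e, t, -, rfl⟩ := Γ.exists_of_notMem x hx
    obtain h | h := le_total (t : ℝ) (1 / 2)
    · refine ⟨_, Γ.edge_zero_mem e, (Γ.dist_edge_le e 0 t).trans ?_⟩
      simpa [abs_of_nonneg t.2.1] using h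
    · refine ⟨_, Γ.edge_one_mem e, (Γ.dist_edge_le e 1 t).trans ?_⟩
      have := t.2.2
      rw [Set.Icc.coe_one, abs_of_nonneg (by linarith)]
      linarith

/-- Around every vertex, the closed star is compact and contains the open unit ball. -/
theorem BoundedValence.exists_isCompact_ball_subset (hΓ : Γ.BoundedValence) {v : X}
    (hv : v ∈ Γ.vertices) : ∃ K, IsCompact K ∧ Metric.ball v 1 ⊆ K := by
  obtain ⟨N, hN⟩ := hΓ
  have hfin : (Γ.edgesAt v).Finite := Set.finite_of_encard_le_coe (hN v hv)
  refine ⟨{v} ∪ ⋃ e ∈ Γ.edgesAt v, Set.range (Γ.edge e), isCompact_singleton.union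
    (hfin.isCompact_biUnion fun e _ => isCompact_range (Γ.continuous_edge e)), fun y hy => ?_⟩
  obtain ⟨ρ, -, h | ⟨e, s, rfl, h⟩⟩ := exists_mem_starBall hv
    (by rwa [dist_comm] : dist v y < 1)
  · exact Or.inl h
  · exact Or.inr (Set.mem_biUnion (x := e) (h.imp And.left And.left) ⟨s, rfl⟩)

theorem BoundedValence.isCompact_closedBall_quarter (hΓ : Γ.BoundedValence) (x : X) :
    IsCompact (Metric.closedBall x (1 / 4)) := by
  obtain ⟨v, hv, hvx⟩ := Γ.exists_vertex_dist_le x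
  obtain ⟨K, hK, hsub⟩ := hΓ.exists_isCompact_ball_subset hv
  refine hK.of_isClosed_subset Metric.isClosed_closedBall fun y hy => hsub ?_
  rw [Metric.mem_closedBall] at hy
  rw [Metric.mem_ball]
  linarith [dist_triangle y x v, dist_comm x v]

end MetricGraph

/-- A geodesic space whose closed balls of some fixed radius are compact is proper. -/
theorem IsDeltaHyperbolic.properSpace {X : Type*} [MetricSpace X] {δ : ℝ}
    (h : IsDeltaHyperbolic δ X) {ε : ℝ} (hε : 0 < ε)
    (hX : ∀ x : X, IsCompact (Metric.closedBall x ε)) : ProperSpace X := by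
  have key : ∀ (u : X) (n : ℕ), IsCompact (Metric.closedBall u (n * (ε / 2))) := by
    intro u n
    induction n with
    | zero => simp
    | succ n ih =>
      obtain ⟨F, -, hF, hcov⟩ := ih.finite_cover_balls (half_pos hε)
      refine (hF.isCompact_biUnion fun x _ => hX x).of_isClosed_subset
        Metric.isClosed_closedBall fun y hy => ?_
      rw [Metric.mem_closedBall, dist_comm] at hy
      obtain ⟨z, hz1, hz2⟩ : ∃ z, dist u z ≤ n * (ε / 2) ∧ dist z y ≤ ε / 2 := by
        obtain hle | hle := le_total (dist u y) (n * (ε / 2))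
        · exact ⟨y, hle, by simpa using (half_pos hε).le⟩
        · obtain ⟨S, hS⟩ := h.geodesic u y
          obtain ⟨z, hz, hz'⟩ := hS.exists_dist_eq (by positivity) hle
          have := hS.dist_add_dist hz
          push_cast at hy
          exact ⟨z, hz'.le, by linarith⟩
      obtain ⟨x, hx, hzx⟩ := Set.mem_iUnion₂.1
        (hcov (Metric.mem_closedBall.2 (by rwa [dist_comm])))
      refine Set.mem_biUnion hx ?_
      rw [Metric.mem_closedBall]
      rw [Metric.mem_ball] at hzx
      linarith [dist_triangle y z x, dist_comm y z]
  refine ProperSpace.of_isCompact_closedBall_of_le 0 fun x r _ => ?_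
  obtain ⟨n, hn⟩ := exists_nat_ge (r / (ε / 2))
  exact (key x n).of_isClosed_subset Metric.isClosed_closedBall
    (Metric.closedBall_subset_closedBall ((div_le_iff₀ (half_pos hε)).1 hn))

theorem MetricGraph.finite_ballVertices {X : Type*} [MetricSpace X] [ProperSpace X]
    (Γ : MetricGraph X) (u : X) (n : ℕ) : (Γ.ballVertices u n).Finite := by
  obtain ⟨F, -, hF, hcov⟩ := (isCompact_closedBall u n).finite_cover_balls
    (half_pos (zero_lt_one (α := ℝ)))
  have : ∀ v ∈ Γ.ballVertices u n, ∃ x ∈ F, dist v x < 1 / 2 := fun v hv => by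
    simpa using Set.mem_iUnion₂.1 (hcov (Metric.mem_closedBall'.2 hv.2))
  choose! f hfF hf using this
  refine Set.Finite.of_finite_image (hF.subset (Set.image_subset_iff.2 hfF)) fun v hv w hw hvw => ?_
  refine MetricGraph.eq_of_dist_lt_one hw.1 hv.1 ?_
  have h1 := hf v hv
  have h2 := hf w hw
  rw [hvw] at h1
  linarith [dist_triangle w (f w) v, dist_comm v (f w)]

/-! ### Geodesic lines between boundary points -/

section Lines

open Filter Topology

variable {X : Type*} [MetricSpace X] {δ : ℝ}

theorem GeodesicRay.dist_eq (α : GeodesicRay X) (s t : ℝ≥0) :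
    dist (α.1 s) (α.1 t) = |(s : ℝ) - t| := by
  rw [α.2.dist_eq, NNReal.dist_eq]

theorem GeodesicRay.dist_zero_left (α : GeodesicRay X) (t : ℝ≥0) :
    dist (α.1 0) (α.1 t) = t := by
  simp [α.dist_eq]

theorem GeodesicRay.isGeodesicSegment (α : GeodesicRay X) (T : ℝ≥0) :
    IsGeodesicSegment (α.1 0) (α.1 T) ((fun t : ℝ => α.1 t.toNNReal) '' Set.Icc 0 (T : ℝ)) := by
  have := isGeodesicSegment_image (c := fun t : ℝ => α.1 t.toNNReal) T.2
    fun s hs t ht => by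
      rw [α.dist_eq, Real.coe_toNNReal _ hs.1, Real.coe_toNNReal _ ht.1]
  simpa using this

theorem GeodesicRay.equiv_of_dist_le {α β : GeodesicRay X} {Q : ℝ}
    (h : ∀ t, dist (α.1 t) (β.1 t) ≤ Q) : geodesicRaySetoid X α β := by
  refine lt_of_le_of_lt (Metric.hausdorffEDist_le_of_mem_edist (r := ENNReal.ofReal Q) ?_ ?_)
    ENNReal.ofReal_lt_top
  · rintro _ ⟨t, rfl⟩
    exact ⟨_, ⟨t, rfl⟩, by rw [edist_dist]; exact ENNReal.ofReal_le_ofReal (h t)⟩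
  · rintro _ ⟨t, rfl⟩
    exact ⟨_, ⟨t, rfl⟩, by rw [edist_dist, dist_comm]; exact ENNReal.ofReal_le_ofReal (h t)⟩

/-- A geodesic segment that ends on a ray and starts near its origin travels along the ray. -/
theorem IsDeltaHyperbolic.dist_ray_le (h : IsDeltaHyperbolic δ X) (β : GeodesicRay X)
    {T : ℝ≥0} {g : ℝ → X} {b K : ℝ} (hb : 0 ≤ b)
    (hg : ∀ s ∈ Set.Icc 0 b, ∀ t ∈ Set.Icc 0 b, dist (g s) (g t) = |s - t|)
    (hgb : g b = β.1 T) (hK : dist (g 0) (β.1 0) ≤ K) {t : ℝ≥0} (ht : (t : ℝ) ≤ b) :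
    dist (g t) (β.1 t) ≤ 2 * δ + 3 * K := by
  have hK0 : 0 ≤ K := dist_nonneg.trans hK
  have hS := isGeodesicSegment_image hb hg
  rw [hgb] at hS
  obtain ⟨A, hA⟩ := h.geodesic (β.1 0) (g 0)
  have hgt : dist (g 0) (g t) = t := by
    rw [hg 0 ⟨le_rfl, hb⟩ t ⟨t.2, ht⟩, zero_sub, abs_neg, abs_of_nonneg t.coe_nonneg]
  have hβt : dist (β.1 0) (β.1 t) = t := β.dist_zero_left t
  obtain ⟨q, hq | hq, hpq⟩ := h.slim _ _ _ _ _ _ hS (β.isGeodesicSegment T).symm hA (g t)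
    ⟨t, ⟨t.2, ht⟩, rfl⟩
  · obtain ⟨s, hs, rfl⟩ := hq
    simp only at hpq
    have h1 : dist (β.1 0) (β.1 s.toNNReal) = s := by
      rw [β.dist_zero_left, Real.coe_toNNReal _ hs.1]
    have h2 : dist (β.1 s.toNNReal) (β.1 t) = |s - t| := by
      rw [β.dist_eq, Real.coe_toNNReal _ hs.1]
    have h3 : |s - t| ≤ δ + K := by
      rw [abs_le]
      constructor
      · linarith [dist_triangle4 (g 0) (β.1 0) (β.1 s.toNNReal) (g t),
          dist_comm (g t) (β.1 s.toNNReal)]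
      · linarith [dist_triangle4 (β.1 0) (g 0) (g t) (β.1 s.toNNReal), dist_comm (β.1 0) (g 0)]
    linarith [dist_triangle (g t) (β.1 s.toNNReal) (β.1 t)]
  · have h1 := hA.dist_add_dist hq
    rw [dist_comm (β.1 0) (g 0)] at h1
    have h2 : dist q (g 0) ≥ 0 := dist_nonneg
    have h3 : dist (β.1 0) q ≥ 0 := dist_nonneg
    linarith [dist_triangle4 (g t) q (β.1 0) (β.1 t), dist_comm q (β.1 0),
      dist_triangle (g 0) q (g t), dist_comm (g t) q, dist_comm (g 0) q]

/-- Segments between the points at time `n` on two non-asymptotic rays pass near a fixed point. -/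
theorem IsDeltaHyperbolic.exists_dist_le_of_not_equiv (h : IsDeltaHyperbolic δ X) (hδ : 0 ≤ δ)
    {α β : GeodesicRay X} (hne : ¬ geodesicRaySetoid X α β) :
    ∃ T : ℝ≥0, ∀ n : ℝ≥0, T ≤ n → ∀ S, IsGeodesicSegment (α.1 n) (β.1 n) S →
      ∃ p ∈ S, dist (α.1 T) p ≤ 2 * δ := by
  obtain ⟨T, hT⟩ : ∃ T, 4 * δ + 3 * dist (α.1 0) (β.1 0) < dist (α.1 T) (β.1 T) := by
    by_contra! hcon
    exact hne (GeodesicRay.equiv_of_dist_le hcon)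
  refine ⟨T, fun n hn S hS => ?_⟩
  have hαT : dist (α.1 0) (α.1 T) = T := α.dist_zero_left T
  have hβT : dist (β.1 0) (β.1 T) = T := β.dist_zero_left T
  have hK0 : 0 ≤ dist (α.1 0) (β.1 0) := dist_nonneg
  obtain ⟨A, hA⟩ := h.geodesic (α.1 n) (β.1 0)
  obtain ⟨B, hB⟩ := h.geodesic (β.1 0) (α.1 0)
  obtain ⟨q, hq | hq, hpq⟩ := h.slim _ _ _ _ _ _ (α.isGeodesicSegment n) hA hB (α.1 T)
    ⟨T, ⟨T.2, hn⟩, by simp⟩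
  · obtain ⟨r, hr | hr, hqr⟩ := h.slim _ _ _ _ _ _ hA.symm hS (β.isGeodesicSegment n).symm q hq
    · exact ⟨r, hr, by linarith [dist_triangle (α.1 T) q r]⟩
    · exfalso
      obtain ⟨s, hs, rfl⟩ := hr
      simp only at hqr
      have h1 : dist (β.1 0) (β.1 s.toNNReal) = s := by
        rw [β.dist_zero_left, Real.coe_toNNReal _ hs.1]
      have h2 : dist (β.1 s.toNNReal) (β.1 T) = |s - T| := by
        rw [β.dist_eq, Real.coe_toNNReal _ hs.1]
      have h4 := dist_triangle (α.1 T) q (β.1 s.toNNReal)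
      have h3 : |s - T| ≤ 2 * δ + dist (α.1 0) (β.1 0) := by
        rw [abs_le]
        constructor
        · linarith [dist_triangle4 (α.1 0) (β.1 0) (β.1 s.toNNReal) (α.1 T),
            dist_comm (α.1 T) (β.1 s.toNNReal)]
        · linarith [dist_triangle4 (β.1 0) (α.1 0) (α.1 T) (β.1 s.toNNReal),
            dist_comm (β.1 0) (α.1 0)]
      linarith [dist_triangle (α.1 T) (β.1 s.toNNReal) (β.1 T)]
  · exfalso
    have h1 := hB.dist_add_dist hq
    rw [dist_comm (β.1 0) (α.1 0)] at h1
    have h3 : dist (β.1 0) q ≥ 0 := dist_nonneg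
    linarith [dist_triangle4 (α.1 T) (α.1 0) (β.1 0) (β.1 T), dist_comm (α.1 0) (α.1 T),
      dist_triangle (α.1 0) q (α.1 T), dist_comm (α.1 0) q, dist_comm (α.1 T) q]

/-- The segments joining the points at time `n` on two non-asymptotic rays can be parametrized by
intervals that exhaust `ℝ`, with time `0` at a point near the origins of the rays. -/
theorem IsDeltaHyperbolic.exists_long_segments (h : IsDeltaHyperbolic δ X) (hδ : 0 ≤ δ)
    {α β : GeodesicRay X} (hne : ¬ geodesicRaySetoid X α β) :
    ∃ K : ℝ, ∀ n : ℝ≥0, K ≤ n → ∃ (g : ℝ → X) (a b : ℝ), n - K ≤ a ∧ n - K ≤ b ∧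
      (∀ s ∈ Set.Icc (-a) b, ∀ t ∈ Set.Icc (-a) b, dist (g s) (g t) = |s - t|) ∧
      g (-a) = α.1 n ∧ g b = β.1 n ∧ dist (g 0) (α.1 0) ≤ K ∧ dist (g 0) (β.1 0) ≤ K := by
  obtain ⟨T, hT⟩ := h.exists_dist_le_of_not_equiv hδ hne
  have hT0 : (0 : ℝ) ≤ T := T.2
  have hK0 : 0 ≤ dist (α.1 0) (β.1 0) := dist_nonneg
  refine ⟨T + 2 * δ + dist (α.1 0) (β.1 0), fun n hn => ?_⟩
  obtain ⟨S, hS⟩ := h.geodesic (α.1 n) (β.1 n)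
  obtain ⟨p, hp, hpT⟩ := hT n (NNReal.coe_le_coe.1 (by linarith)) S hS
  have hαT : dist (α.1 0) (α.1 T) = T := α.dist_zero_left T
  have hαn : dist (α.1 0) (α.1 n) = n := α.dist_zero_left n
  have hβn : dist (β.1 0) (β.1 n) = n := β.dist_zero_left n
  have hsum := hS.dist_add_dist hp
  have hpα : dist p (α.1 0) ≤ T + 2 * δ := by
    linarith [dist_triangle p (α.1 T) (α.1 0), dist_comm p (α.1 T), dist_comm (α.1 0) (α.1 T)]
  have hpβ : dist p (β.1 0) ≤ T + 2 * δ + dist (α.1 0) (β.1 0) := by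
    linarith [dist_triangle p (α.1 0) (β.1 0)]
  obtain ⟨c, h0, h1, hc, rfl⟩ := hS
  obtain ⟨τ, hτ, rfl⟩ := hp
  have e0 := hc 0 ⟨le_rfl, dist_nonneg⟩ τ hτ
  rw [h0, zero_sub, abs_neg, abs_of_nonneg hτ.1] at e0
  refine ⟨fun t => c (τ + t), τ, dist (α.1 n) (β.1 n) - τ, ?_, ?_, ?_, ?_, ?_, ?_, ?_⟩
  · linarith [dist_triangle (α.1 0) (c τ) (α.1 n), dist_comm (α.1 0) (c τ),
      dist_comm (α.1 n) (c τ)]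
  · linarith [dist_triangle (β.1 0) (c τ) (β.1 n), dist_comm (β.1 0) (c τ)]
  · intro s hs t ht
    rw [hc _ ⟨by linarith [hs.1], by linarith [hs.2]⟩ _ ⟨by linarith [ht.1], by linarith [ht.2]⟩]
    congr 1; ring
  · simpa using h0
  · simpa using h1
  · simpa using hpα.trans (by linarith)
  · simpa using hpβ

/-- Visibility: in a proper hyperbolic space, two distinct boundary points are joined by a geodesic
line, namely by a limit of the segments between two rays. -/
theorem IsDeltaHyperbolic.exists_joins [ProperSpace X] (h : IsDeltaHyperbolic δ X) (hδ : 0 ≤ δ)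
    {ξ η : GeodesicBoundary X} (hne : ξ ≠ η) : ∃ γ : GeodesicLine X, γ.Joins ξ η := by
  obtain ⟨α, rfl⟩ := Quotient.exists_rep ξ
  obtain ⟨β, rfl⟩ := Quotient.exists_rep η
  have hne' : ¬ geodesicRaySetoid X α β := fun hαβ => hne (Quotient.sound hαβ)
  obtain ⟨K, hK⟩ := h.exists_long_segments hδ hne'
  have hK' : ∀ n : ℕ, ∃ (g : ℝ → X) (a b : ℝ), K ≤ n → (n - K ≤ a ∧ n - K ≤ b ∧
      (∀ s ∈ Set.Icc (-a) b, ∀ t ∈ Set.Icc (-a) b, dist (g s) (g t) = |s - t|) ∧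
      g (-a) = α.1 n ∧ g b = β.1 n ∧ dist (g 0) (α.1 0) ≤ K ∧ dist (g 0) (β.1 0) ≤ K) := by
    intro n
    by_cases hn : K ≤ n
    · obtain ⟨g, a, b, H⟩ := hK n (by simpa using hn)
      exact ⟨g, a, b, fun _ => by simpa using H⟩
    · exact ⟨fun _ => α.1 0, 0, 0, fun h => absurd h hn⟩
  choose g a b hg using hK'
  have hlarge : ∀ R : ℝ, ∀ᶠ n : ℕ in atTop, K + R ≤ n := fun R =>
    tendsto_natCast_atTop_atTop.eventually_ge_atTop (K + R)
  have hisom : ∀ s t : ℝ, ∀ᶠ n in atTop, dist (g n s) (g n t) = |s - t| := by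
    intro s t
    filter_upwards [hlarge 0, hlarge |s|, hlarge |t|] with n hn hns hnt
    obtain ⟨ha, hb, hd, -⟩ := hg n (by linarith)
    exact hd s ⟨by linarith [neg_abs_le s], by linarith [le_abs_self s]⟩ t
      ⟨by linarith [neg_abs_le t], by linarith [le_abs_self t]⟩
  have hbdd : ∀ t : ℝ, ∀ᶠ n in atTop, g n t ∈ Metric.closedBall (α.1 0) (K + |t|) := by
    intro t
    filter_upwards [hisom t 0, hlarge 0] with n hn hn0
    obtain ⟨-, -, -, -, -, hα, -⟩ := hg n (by linarith)
    rw [sub_zero] at hn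
    rw [Metric.mem_closedBall]
    linarith [dist_triangle (g n t) (g n 0) (α.1 0)]
  have hpos : ∀ t : ℝ≥0, ∀ᶠ n in atTop, dist (g n t) (β.1 t) ≤ 2 * δ + 3 * K := by
    intro t
    filter_upwards [hlarge 0, hlarge t] with n hn hnt
    obtain ⟨ha, hb, hd, -, hgb, -, hβ⟩ := hg n (by linarith)
    have ht0 : (0 : ℝ) ≤ t := t.2
    refine h.dist_ray_le β (b := b n) (by linarith) (fun s hs t ht => hd s ?_ t ?_) hgb hβ
      (by linarith)
    · exact ⟨by linarith [hs.1], hs.2⟩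
    · exact ⟨by linarith [ht.1], ht.2⟩
  have hneg : ∀ t : ℝ≥0, ∀ᶠ n in atTop, dist (g n (-t)) (α.1 t) ≤ 2 * δ + 3 * K := by
    intro t
    filter_upwards [hlarge 0, hlarge t] with n hn hnt
    obtain ⟨ha, hb, hd, hga, -, hα, -⟩ := hg n (by linarith)
    have ht0 : (0 : ℝ) ≤ t := t.2
    refine h.dist_ray_le α (g := fun s => g n (-s)) (b := a n) (by linarith)
      (fun s hs t ht => ?_) hga (by simpa using hα) (by linarith)
    rw [hd (-s) ⟨by linarith [hs.2], by linarith [hs.1]⟩ (-t)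
      ⟨by linarith [ht.2], by linarith [ht.1]⟩, ← abs_neg]
    congr 1; ring
  -- A non-principal ultrafilter provides all pointwise limits at once.
  have hU : (hyperfilter ℕ : Filter ℕ) ≤ atTop := Nat.hyperfilter_le_atTop
  have hlim : ∀ t : ℝ, ∃ x, Tendsto (fun n => g n t) (hyperfilter ℕ) (𝓝 x) := by
    intro t
    obtain ⟨x, -, hx⟩ := (isCompact_closedBall (α.1 0) (K + |t|)).ultrafilter_le_nhds'
      ((hyperfilter ℕ).map fun n => g n t) (hU (hbdd t))
    exact ⟨x, hx⟩
  choose γ hγ using hlim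
  have hγiso : Isometry γ := Isometry.of_dist_eq fun s t => by
    rw [Real.dist_eq]
    refine tendsto_nhds_unique ((hγ s).dist (hγ t)) (tendsto_const_nhds.congr' ?_)
    filter_upwards [hU (hisom s t)] with n hn using hn.symm
  refine ⟨⟨γ, hγiso⟩, Quotient.sound ?_, Quotient.sound ?_⟩
  · exact GeodesicRay.equiv_of_dist_le fun t =>
      le_of_tendsto ((hγ _).dist tendsto_const_nhds) (hU (hneg t))
  · exact GeodesicRay.equiv_of_dist_le fun t =>
      le_of_tendsto ((hγ _).dist tendsto_const_nhds) (hU (hpos t))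

end Lines

/-! ### Branching at a barycenter -/

section Branching

variable {X : Type*} [MetricSpace X] {δ : ℝ}

theorem GeodesicLine.gromovProduct_le_dist (γ : GeodesicLine X) (v : X) {s t₀ t : ℝ}
    (hs : s ≤ t₀) (ht : t₀ ≤ t) : gromovProduct v (γ.1 s) (γ.1 t) ≤ dist v (γ.1 t₀) := by
  refine gromovProduct_le_dist_of_between v ?_
  rw [γ.2.dist_eq, γ.2.dist_eq, γ.2.dist_eq, Real.dist_eq, Real.dist_eq, Real.dist_eq,
    abs_of_nonpos (by linarith), abs_of_nonpos (by linarith), abs_of_nonpos (by linarith)]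
  ring

/-- If `γ(∞) = γ'(-∞)`, then points far out on the two ends have large Gromov product. -/
theorem GeodesicLine.exists_le_gromovProduct {γ γ' : GeodesicLine X}
    (h : geodesicRaySetoid X γ.posRay γ'.negRay) (v : X) (t₀ s₀ M : ℝ) :
    ∃ t ≥ t₀, ∃ s ≤ s₀, M ≤ dist v (γ.1 t) ∧ M ≤ gromovProduct v (γ.1 t) (γ'.1 s) := by
  obtain ⟨H, hH, -⟩ := ENNReal.lt_iff_exists_nnreal_btwn.1 h
  set t : ℝ≥0 := ⟨|t₀| + |s₀| + |M| + H + dist v (γ.1 0) + dist (γ.1 0) (γ'.1 0), by positivity⟩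
  obtain ⟨_, ⟨s, rfl⟩, hs⟩ := Metric.exists_edist_lt_of_hausdorffEDist_lt
    (Set.mem_range_self t) hH
  have hts : dist (γ.1 t) (γ'.1 (-s)) < H := by
    rw [edist_nndist, ENNReal.coe_lt_coe, ← NNReal.coe_lt_coe, coe_nndist] at hs
    exact hs
  have ht' : (t : ℝ) = |t₀| + |s₀| + |M| + H + dist v (γ.1 0) + dist (γ.1 0) (γ'.1 0) := rfl
  have h0 : dist (γ.1 0) (γ.1 t) = t := by
    rw [γ.2.dist_eq, Real.dist_eq, zero_sub, abs_neg, abs_of_nonneg t.coe_nonneg]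
  have h0' : dist (γ'.1 0) (γ'.1 (-s)) = s := by
    rw [γ'.2.dist_eq, Real.dist_eq, zero_sub, neg_neg, abs_of_nonneg s.coe_nonneg]
  have hH0 : (0 : ℝ) ≤ H := H.coe_nonneg
  have a1 := le_abs_self t₀
  have a2 := neg_abs_le s₀
  have a3 := le_abs_self M
  have b1 := abs_nonneg t₀
  have b2 := abs_nonneg s₀
  have b3 := abs_nonneg M
  have c1 : dist v (γ.1 0) ≥ 0 := dist_nonneg
  have c2 : dist (γ.1 0) (γ'.1 0) ≥ 0 := dist_nonneg
  have d1 := dist_triangle (γ.1 0) v (γ.1 t)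
  have d2 := dist_comm (γ.1 0) v
  refine ⟨t, by linarith, -s, ?_, by linarith, ?_⟩
  · linarith [dist_triangle4 (γ.1 0) (γ'.1 0) (γ'.1 (-s)) (γ.1 t),
      dist_comm (γ.1 t) (γ'.1 (-s))]
  · unfold gromovProduct
    linarith [dist_triangle v (γ'.1 (-s)) (γ.1 t), dist_comm (γ.1 t) (γ'.1 (-s))]

/-- Near a barycenter there is a tripod with arbitrarily long legs. -/
theorem IsDeltaHyperbolic.exists_tripod [ProperSpace X] (h : IsDeltaHyperbolic δ X) (hδ : 0 ≤ δ)
    {D L : ℝ} {ξ : BoundaryTriple X} {v b : X} (hb : IsBarycenter D ξ b) (hv : dist v b ≤ L)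
    (M : ℝ) : ∃ x : Fin 3 → X, (∀ i, M ≤ dist v (x i)) ∧
      ∀ i j, i ≠ j → gromovProduct v (x i) (x j) ≤ L + D + 1 + 3 * δ := by
  have hsucc : ∀ i : Fin 3, i ≠ i + 1 := by decide
  have hline : ∀ i : Fin 3, ∃ γ : GeodesicLine X, γ.Joins (ξ.1 i) (ξ.1 (i + 1)) := fun i =>
    h.exists_joins hδ (ξ.2.ne (hsucc i))
  choose γ hγ using hline
  have hnear : ∀ i, ∃ t, dist v ((γ i).1 t) ≤ L + D + 1 := by
    intro i
    obtain ⟨_, ⟨t, rfl⟩, ht⟩ := (Metric.infDist_lt_iff (Set.range_nonempty _)).1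
      ((hb i (i + 1) (hsucc i) (γ i) (hγ i)).trans_lt (lt_add_one D))
    exact ⟨t, by linarith [dist_triangle v b ((γ i).1 t)]⟩
  choose t₀ ht₀ using hnear
  have hends : ∀ i, geodesicRaySetoid X (γ i).posRay (γ (i + 1)).negRay := fun i =>
    Quotient.exact ((hγ i).2.trans (hγ (i + 1)).1.symm)
  have hpair := fun i => GeodesicLine.exists_le_gromovProduct (hends i) v (t₀ i) (t₀ (i + 1))
    (max M (L + D + 1 + 3 * δ + 1))
  choose t ht s hs hM hprod using hpair
  have key : ∀ i, gromovProduct v ((γ i).1 (t i)) ((γ (i + 1)).1 (t (i + 1))) ≤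
      L + D + 1 + 3 * δ := by
    intro i
    have h1 := h.min_gromovProduct_le v ((γ (i + 1)).1 (s i)) ((γ i).1 (t i))
      ((γ (i + 1)).1 (t (i + 1)))
    have h2 := ((γ (i + 1)).gromovProduct_le_dist v (hs i) (ht (i + 1))).trans (ht₀ (i + 1))
    have h3 := (le_max_right _ _).trans (hprod i)
    rw [gromovProduct_comm] at h3
    obtain h4 | h4 := min_le_iff.1 h1 <;> linarith
  refine ⟨fun i => (γ i).1 (t i), fun i => (le_max_left _ _).trans (hM i), fun i j hij => ?_⟩
  have hcyc : ∀ i j : Fin 3, i ≠ j → j = i + 1 ∨ i = j + 1 := by decide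
  obtain rfl | rfl := hcyc i j hij
  · exact key i
  · rw [gromovProduct_comm]; exact key j

/-- Whatever direction one comes from, at least two legs of a tripod lead away from it. -/
theorem IsDeltaHyperbolic.exists_ne_gromovProduct_le (h : IsDeltaHyperbolic δ X) {v : X} {C : ℝ}
    {x : Fin 3 → X} (hx : ∀ i j, i ≠ j → gromovProduct v (x i) (x j) ≤ C) (u : X) :
    ∃ i j, i ≠ j ∧ gromovProduct v u (x i) ≤ C + 3 * δ ∧ gromovProduct v u (x j) ≤ C + 3 * δ := by
  have key : ∀ i j, i ≠ j →
      gromovProduct v u (x i) ≤ C + 3 * δ ∨ gromovProduct v u (x j) ≤ C + 3 * δ := by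
    intro i j hij
    have h1 := h.min_gromovProduct_le v (x i) u (x j)
    rw [gromovProduct_comm v (x i) u] at h1
    exact (min_le_iff.1 h1).imp (fun h2 => by linarith [hx i j hij])
      (fun h2 => by linarith [hx i j hij])
  by_cases h0 : gromovProduct v u (x 0) ≤ C + 3 * δ
  · obtain h1 | h1 := key 1 2 (by decide)
    · exact ⟨0, 1, by decide, h0, h1⟩
    · exact ⟨0, 2, by decide, h0, h1⟩
  · exact ⟨1, 2, by decide, (key 0 1 (by decide)).resolve_left h0,
      (key 0 2 (by decide)).resolve_left h0⟩

/-- A vertex near a barycenter can be continued in two different directions, both leading away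
from a given point `u`. -/
theorem MetricGraph.exists_branches [ProperSpace X] (Γ : MetricGraph X)
    (h : IsDeltaHyperbolic δ X) (hδ : 0 ≤ δ) {D L : ℝ} {ξ : BoundaryTriple X} {v b : X}
    (hb : IsBarycenter D ξ b) (hv : dist v b ≤ L) (u : X) {r : ℝ} (hr : 0 ≤ r) :
    ∃ y : Bool → X, (∀ i, y i ∈ Γ.vertices ∧ r - 1 ≤ dist v (y i) ∧ dist v (y i) ≤ r + 1 ∧
      gromovProduct v u (y i) ≤ L + D + 2 + 6 * δ) ∧
      gromovProduct v (y false) (y true) ≤ L + D + 2 + 3 * δ := by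
  obtain ⟨x, hM, hx⟩ := h.exists_tripod hδ hb hv r
  have hvert : ∀ i, ∃ z y, dist v z = r ∧ dist v z + dist z (x i) = dist v (x i) ∧
      y ∈ Γ.vertices ∧ dist z y ≤ 1 / 2 := by
    intro i
    obtain ⟨S, hS⟩ := h.geodesic v (x i)
    obtain ⟨z, hz, hzr⟩ := hS.exists_dist_eq hr (hM i)
    obtain ⟨y, hy, hyz⟩ := Γ.exists_vertex_dist_le z
    exact ⟨z, y, hzr, hS.dist_add_dist hz, hy, by rwa [dist_comm]⟩
  choose z y hzr hz hy hzy using hvert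
  have hmove : ∀ u i, gromovProduct v u (y i) ≤ gromovProduct v u (x i) + 1 / 2 := fun u i =>
    (gromovProduct_le_add_dist v u (z i) (y i)).trans
      (add_le_add (gromovProduct_le_of_between u (hz i)) (hzy i))
  have hy' : ∀ i, gromovProduct v u (x i) ≤ L + D + 1 + 3 * δ + 3 * δ →
      y i ∈ Γ.vertices ∧ r - 1 ≤ dist v (y i) ∧ dist v (y i) ≤ r + 1 ∧
      gromovProduct v u (y i) ≤ L + D + 2 + 6 * δ := fun i hi =>
    ⟨hy i, by linarith [dist_triangle v (y i) (z i), dist_comm (y i) (z i), hzr i, hzy i],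
      by linarith [dist_triangle v (z i) (y i), hzr i, hzy i], by linarith [hmove u i]⟩
  obtain ⟨i, j, hij, hi, hj⟩ := h.exists_ne_gromovProduct_le hx u
  refine ⟨fun k => bif k then y j else y i, ?_, ?_⟩
  · rintro (_ | _)
    · exact hy' i hi
    · exact hy' j hj
  · have h1 := hmove (y i) j
    have h2 := hmove (x j) i
    rw [gromovProduct_comm v (x j), gromovProduct_comm v (x j)] at h2
    change gromovProduct v (y i) (y j) ≤ _
    linarith [hx i j hij]

end Branching

/-! ### Exponential growth -/

namespace MetricGraph

variable {X : Type*} [MetricSpace X] (Γ : MetricGraph X) {δ : ℝ}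

/-- The vertices of the ball of radius `n` around `v` that lie, up to an error `C`, behind `v` as
seen from `u`. -/
def shadow (C : ℝ) (u v : X) (n : ℕ) : Set X :=
  {w | w ∈ Γ.ballVertices v n ∧ gromovProduct v u w ≤ C}

variable {Γ}

/-- The Gromov product condition defining a shadow only has to be propagated over one branching
step, since the new shadow is taken as seen from the previous vertex `v`. -/
theorem shadow_subset (h : IsDeltaHyperbolic δ X) {C₀ : ℝ} {u v y : X} {r n : ℕ}
    (hr : 2 * (C₀ + 3 * δ) + 1 < r) (h1 : r - 1 ≤ dist v y) (h2 : dist v y ≤ r + 1)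
    (hu : gromovProduct v u y ≤ C₀) :
    Γ.shadow (C₀ + 3 * δ) v y n ⊆ Γ.shadow (C₀ + 3 * δ) u v (n + (r + 1)) ∩
      {w | C₀ + 3 * δ < gromovProduct v y w} := by
  rintro w ⟨⟨hw, hyw⟩, hC⟩
  have h3 := gromovProduct_add_gromovProduct v y w
  have h4 : C₀ + 3 * δ < gromovProduct v y w := by linarith
  refine ⟨⟨⟨hw, ?_⟩, ?_⟩, h4⟩
  · push_cast
    linarith [dist_triangle v y w]
  · have h5 := h.min_gromovProduct_le v u w y
    rw [gromovProduct_comm v w y] at h5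
    obtain h6 | h6 := min_le_iff.1 h5 <;> linarith

theorem two_pow_le_ncard_shadow [ProperSpace X] (h : IsDeltaHyperbolic δ X) (hδ : 0 ≤ δ) {C₀ : ℝ}
    (hC₀ : 0 ≤ C₀) {r : ℕ} (hr : 2 * (C₀ + 3 * δ) + 1 < r)
    (hΓ : ∀ v ∈ Γ.vertices, ∀ u, ∃ y : Bool → X, (∀ i, y i ∈ Γ.vertices ∧ r - 1 ≤ dist v (y i) ∧
      dist v (y i) ≤ r + 1 ∧ gromovProduct v u (y i) ≤ C₀) ∧
      gromovProduct v (y false) (y true) ≤ C₀) (k : ℕ) :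
    ∀ v ∈ Γ.vertices, ∀ u, 2 ^ k ≤ (Γ.shadow (C₀ + 3 * δ) u v (k * (r + 1))).ncard := by
  have hfin : ∀ u v n, (Γ.shadow (C₀ + 3 * δ) u v n).Finite := fun u v n =>
    (Γ.finite_ballVertices v n).subset fun w hw => hw.1
  induction k with
  | zero =>
    intro v hv u
    rw [pow_zero, Nat.one_le_iff_ne_zero, ← Nat.pos_iff_ne_zero, Set.ncard_pos (hfin _ _ _)]
    refine ⟨v, ⟨hv, by simp⟩, ?_⟩
    simp only [gromovProduct, dist_self, dist_comm u v]
    linarith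
  | succ k ih =>
    intro v hv u
    obtain ⟨y, hy, hyy⟩ := hΓ v hv u
    have hsub := fun i => shadow_subset (Γ := Γ) (n := k * (r + 1)) h hr (hy i).2.1 (hy i).2.2.1
      (hy i).2.2.2
    have hdisj : Disjoint (Γ.shadow (C₀ + 3 * δ) v (y false) (k * (r + 1)))
        (Γ.shadow (C₀ + 3 * δ) v (y true) (k * (r + 1))) := by
      rw [Set.disjoint_left]
      intro w h1 h2
      have h3 : C₀ + 3 * δ < gromovProduct v (y false) w := (hsub false h1).2
      have h4 : C₀ + 3 * δ < gromovProduct v (y true) w := (hsub true h2).2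
      have h5 := h.min_gromovProduct_le v (y false) w (y true)
      rw [gromovProduct_comm v w] at h5
      linarith [lt_min h3 h4]
    calc 2 ^ (k + 1) = 2 ^ k + 2 ^ k := by ring
      _ ≤ _ := add_le_add (ih _ (hy false).1 v) (ih _ (hy true).1 v)
      _ = _ := (Set.ncard_union_eq hdisj (hfin _ _ _) (hfin _ _ _)).symm
      _ ≤ _ := Set.ncard_le_ncard (Set.union_subset (fun w hw => (hsub false hw).1)
          (fun w hw => (hsub true hw).1)) (hfin _ _ _)
      _ = _ := by rw [add_one_mul]

end MetricGraph

theorem theorem3p6 (D : ℝ → ℝ) (δ L : ℝ) (hδ : 0 ≤ δ) (hL : 0 ≤ L) :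
    ∃ a b : ℝ, 0 < a ∧ 1 < b ∧
      ∀ (X : Type*) [MetricSpace X] (Γ : MetricGraph X) (bary : BoundaryTriple X → X),
        IsDeltaHyperbolic δ X → Γ.BoundedValence →
        IsBarycenterMap (D δ) bary → IsCoarselySurjective L bary →
          Γ.HasExponentialGrowthWith a b := by
  set C₀ := L + |D δ| + 2 + 6 * δ with hC₀
  have hD := le_abs_self (D δ)
  have hC₀0 : 0 ≤ C₀ := by positivity
  obtain ⟨r, hr⟩ := exists_nat_gt (2 * (C₀ + 3 * δ) + 1)
  -- the number of vertices at least doubles whenever the radius grows by `r + 1`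
  set b : ℝ := 2 ^ ((r + 1 : ℕ) : ℝ)⁻¹ with hb
  have hbpow : b ^ (r + 1) = 2 := Real.rpow_inv_natCast_pow (by norm_num) (Nat.succ_ne_zero r)
  have hb1 : 1 < b := Real.one_lt_rpow (by norm_num) (by positivity)
  refine ⟨1 / 2, b, by norm_num, hb1, fun X _ Γ bary h hval hbary hsurj => ?_⟩
  have := h.properSpace (by norm_num : (0 : ℝ) < 1 / 4) hval.isCompact_closedBall_quarter
  refine ⟨by norm_num, hb1, fun u hu n => ⟨Γ.finite_ballVertices u n, ?_⟩⟩
  have hgrow := MetricGraph.two_pow_le_ncard_shadow (Γ := Γ) h hδ hC₀0 hr (fun v hv u => by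
    obtain ⟨ξ, hξ⟩ := hsurj v
    obtain ⟨y, hy, hyy⟩ := Γ.exists_branches h hδ (hbary ξ) hξ u r.cast_nonneg
    exact ⟨y, fun i => ⟨(hy i).1, (hy i).2.1, (hy i).2.2.1, by linarith [(hy i).2.2.2]⟩,
      by linarith⟩) (n / (r + 1)) u hu u
  have hsub : Γ.shadow (C₀ + 3 * δ) u u (n / (r + 1) * (r + 1)) ⊆ Γ.ballVertices u n :=
    fun w hw => ⟨hw.1.1, hw.1.2.trans (Nat.cast_le.2 (Nat.div_mul_le_self n (r + 1)))⟩
  have hcard := hgrow.trans (Set.ncard_le_ncard hsub (Γ.finite_ballVertices u n))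
  have hpow : b ^ n ≤ 2 ^ (n / (r + 1) + 1) := by
    rw [← hbpow, ← pow_mul]
    exact pow_le_pow_right₀ hb1.le (Nat.lt_mul_div_succ n (Nat.succ_pos r)).le
  calc 1 / 2 * b ^ n ≤ 1 / 2 * 2 ^ (n / (r + 1) + 1) := by gcongr
    _ = ((2 ^ (n / (r + 1)) : ℕ) : ℝ) := by push_cast; ring
    _ ≤ _ := Nat.cast_le.2 hcard
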